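/- All rings are commutative with unity. Let $R$ be a ring. An ideal $J$ of $R$ is a GV-ideal if it is finitely generated and the natural map $R\to \mathrm{Hom}_R(J,R)$, $r\mapsto (j\mapsto rj)$, is an isomorphism. For an $R$-module $M$ put $\mathrm{tor}_{GV}(M)=\{x\in M : Jx=0 \text{ for some GV-ideal } J\}$; $M$ is GV-torsion if $\mathrm{tor}_{GV}(M)=M$ and GV-torsion-free if $\mathrm{tor}_{GV}(M)=0$. A GV-torsion-free module $M$ is a $w$-module if $\mathrm{Ext}^1_R(R/J,M)=0$ for every GV-ideal $J$, and for a GV-torsion-free module $M$ with injective hull $E(M)$ one puts $M_w=\{x\in E(M): Jx\subseteq M\text{ for some GV-ideal }J\}$. A maximal $w$-ideal is an ideal maximal among the proper ideals of $R$ that are $w$-modules; such ideals are prime. A sequence of $R$-modules and homomorphisms is $w$-exact if its localization at every maximal $w$-ideal is exact. An $R$-module is torsion-free if every non-zero-divisor of $R$ acts injectively on it. For an $R$-module $M$ let $L(M)=(M/\mathrm{tor}_{GV}(M))_w$. The module $M$ is $w$-projective if $\mathrm{Ext}^1_R(L(M),N)$ is GV-torsion for every torsion-free $w$-module $N$, and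 it is $w$-split if $\mathrm{Ext}^1_R(M,N)$ is GV-torsion for every $R$-module $N$. Let $\mathcal P_w^{\dagger_\infty}$ be the class of GV-torsion-free $R$-modules $N$ such that $\mathrm{Ext}^k_R(P,N)=0$ for all $w$-projective $R$-modules $P$ and all $k\ge 1$. The module $M$ is weak $w$-projective if $\mathrm{Ext}^1_R(M,N)=0$ for all $N\in\mathcal P_w^{\dagger_\infty}$. **Proposition.** Let $R$ be a ring and let $M$ be a finitely presented $R$-module. Then the following statements are equivalent: 1. $M$ is $w$-split. 2. $M$ is weak $w$-projective. 3. For every $w$-exact sequence $0\to A\to B\to C\to 0$ of $R$-modules, the sequence $0\to \mathrm{Hom}_R(M,A)\to \mathrm{Hom}_R(M,B)\to \mathrm{Hom}_R(M,C)\to 0$ is $w$-exact. -/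

import Mathlib

universe u

namespace WOp

open CategoryTheory CategoryTheory.Abelian

section GV

variable (R : Type u) [CommRing R]

/-- `J` is a Glaz–Vasconcelos ideal: it is finitely generated and the natural map
`R → Hom_R(J, R)`, `r ↦ (j ↦ r j)`, is an isomorphism. -/
def IsGVIdeal (J : Ideal R) : Prop :=
  J.FG ∧ Function.Bijective (fun r : R => (r • J.subtype : J →ₗ[R] R))

variable {R}

theorem IsGVIdeal.eq_zero {J : Ideal R} (hJ : IsGVIdeal R J) {x : R}
    (hx : ∀ j ∈ J, j * x = 0) : x = 0 := by
  apply hJ.2.1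
  ext j
  simpa [mul_comm] using hx j j.2

theorem IsGVIdeal.exists_mul {J : Ideal R} (hJ : IsGVIdeal R J) (f : J →ₗ[R] R) :
    ∃ r : R, ∀ j : J, f j = j * r := by
  obtain ⟨r, hr⟩ := hJ.2.2 f
  refine ⟨r, fun j => ?_⟩
  rw [← hr]
  simp [mul_comm]

theorem isGVIdeal_top : IsGVIdeal R ⊤ := by
  refine ⟨Ideal.fg_top R, fun a b h => ?_, fun f => ⟨f ⟨1, trivial⟩, ?_⟩⟩
  · simpa using LinearMap.congr_fun h (⟨1, trivial⟩ : (⊤ : Ideal R))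
  · ext ⟨x, hx⟩
    have : (⟨x, hx⟩ : (⊤ : Ideal R)) = x • ⟨1, trivial⟩ := by ext; simp
    rw [this, map_smul]
    simp [mul_comm]

theorem IsGVIdeal.mul {I J : Ideal R} (hI : IsGVIdeal R I) (hJ : IsGVIdeal R J) :
    IsGVIdeal R (I * J) := by
  refine ⟨hI.1.mul hJ.1, fun a b h => ?_, fun f => ?_⟩
  · rw [← sub_eq_zero]
    refine hI.eq_zero fun i hi => hJ.eq_zero fun j hj => ?_
    have := LinearMap.congr_fun h ⟨i * j, Ideal.mul_mem_mul hi hj⟩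
    simp only [LinearMap.smul_apply, Submodule.subtype_apply, smul_eq_mul] at this
    linear_combination this
  · have key : ∀ i : I, ∃ r : R, ∀ j : J,
        f ⟨i * j, Ideal.mul_mem_mul i.2 j.2⟩ = j * r := by
      intro i
      let g : J →ₗ[R] R :=
        { toFun := fun j => f ⟨i * j, Ideal.mul_mem_mul i.2 j.2⟩
          map_add' := fun x y => by
            rw [← map_add]; congr 1; ext; simp [mul_add]
          map_smul' := fun c x => by
            rw [← map_smul]; congr 1; ext; simp [mul_left_comm] }
      exact hJ.exists_mul g
    choose r hr using key
    let g : I →ₗ[R] R :=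
      { toFun := r
        map_add' := fun x y => by
          rw [← sub_eq_zero]
          refine hJ.eq_zero fun j hj => ?_
          rw [mul_sub, mul_add, ← hr _ ⟨j, hj⟩, ← hr _ ⟨j, hj⟩, ← hr _ ⟨j, hj⟩, ← map_add,
            ← map_sub]
          convert map_zero f
          ext; simp [add_mul]
        map_smul' := fun c x => by
          rw [← sub_eq_zero]
          refine hJ.eq_zero fun j hj => ?_
          rw [RingHom.id_apply, smul_eq_mul, mul_sub, mul_left_comm, ← hr _ ⟨j, hj⟩,
            ← hr _ ⟨j, hj⟩]
          have e : (⟨((c • x : I) : R) * j, Ideal.mul_mem_mul (c • x : I).2 hj⟩ : ↥(I * J)) =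
              c • ⟨x * j, Ideal.mul_mem_mul x.2 hj⟩ := Subtype.ext (by simp [mul_assoc])
          rw [e, map_smul, smul_eq_mul, sub_self] }
    obtain ⟨s, hs⟩ := hI.exists_mul g
    refine ⟨s, ?_⟩
    ext ⟨x, hx⟩
    induction hx using Submodule.mul_induction_on' with
    | mem_mul_mem i hi j hj =>
      have h1 := hr ⟨i, hi⟩ ⟨j, hj⟩
      have h2 := hs ⟨i, hi⟩
      simp only [g, LinearMap.coe_mk, AddHom.coe_mk] at h1 h2
      simp only [LinearMap.smul_apply, Submodule.subtype_apply, smul_eq_mul]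
      rw [h1, h2]; ring
    | add x hx y hy h1 h2 =>
      have e : (⟨x + y, Submodule.add_mem _ hx hy⟩ : ↥(I * J)) = ⟨x, hx⟩ + ⟨y, hy⟩ := rfl
      rw [e, map_add (s • (I * J).subtype), map_add f, h1, h2]

end GV

section Torsion

variable (R : Type u) [CommRing R] (M : Type*) [AddCommGroup M] [Module R M]

/-- The submodule of all elements of `M` that some GV-ideal multiplies into `N`. -/
def gvClosure {M : Type*} [AddCommGroup M] [Module R M] (N : Submodule R M) :
    Submodule R M where
  carrier := {x | ∃ J : Ideal R, IsGVIdeal R J ∧ ∀ j ∈ J, j • x ∈ N}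
  zero_mem' := ⟨⊤, isGVIdeal_top, fun j _ => by rw [smul_zero]; exact N.zero_mem⟩
  add_mem' := fun {x y} ⟨I, hI, hx⟩ ⟨J, hJ, hy⟩ =>
    ⟨I * J, hI.mul hJ, fun j hj => by
      rw [smul_add]
      exact N.add_mem (hx j (Ideal.mul_le_left hj)) (hy j (Ideal.mul_le_right hj))⟩
  smul_mem' := fun c x ⟨J, hJ, hx⟩ =>
    ⟨J, hJ, fun j hj => by
      rw [smul_comm]
      exact N.smul_mem c (hx j hj)⟩

/-- `tor_GV(M) = {x ∈ M | J x = 0 for some GV-ideal J}`. -/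
def torGV : Submodule R M := gvClosure R (⊥ : Submodule R M)

theorem mem_torGV {M : Type*} [AddCommGroup M] [Module R M] {x : M} :
    x ∈ torGV R M ↔ ∃ J : Ideal R, IsGVIdeal R J ∧ ∀ j ∈ J, j • x = 0 :=
  Iff.rfl

/-- `M` is GV-torsion. -/
def IsGVTorsion : Prop := torGV R M = ⊤

/-- `M` is GV-torsion-free. -/
def IsGVTorsionFree : Prop := torGV R M = ⊥

end Torsion

section WModule

variable (R : Type u) [CommRing R]

/-- `Ext^n_R(M, N)`, an `R`-module. -/
noncomputable abbrev ExtR (M N : Type u) [AddCommGroup M] [Module R M]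
    [AddCommGroup N] [Module R N] (n : ℕ) : Type u :=
  Ext (ModuleCat.of R M) (ModuleCat.of R N) n

/-- A `w`-module: a GV-torsion-free module `M` with `Ext^1_R(R/J, M) = 0` for all GV-ideals `J`. -/
def IsWModule (M : Type u) [AddCommGroup M] [Module R M] : Prop :=
  IsGVTorsionFree R M ∧
    ∀ J : Ideal R, IsGVIdeal R J → Subsingleton (ExtR R (R ⧸ J) M 1)

/-- A maximal `w`-ideal: an ideal that is maximal among the proper ideals of `R` that are
`w`-modules. -/
def IsMaximalWIdeal (m : Ideal R) : Prop :=
  Maximal (fun I : Ideal R => I ≠ ⊤ ∧ IsWModule R I) m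

variable {R}

theorem shortExact_quot (J : Ideal R) :
    (ModuleCat.shortComplexOfCompEqZero J.subtype J.mkQ
      (LinearMap.exact_subtype_mkQ J).linearMap_comp_eq_zero).ShortExact where
  exact := (ShortComplex.ShortExact.moduleCat_exact_iff_function_exact _).mpr
    (LinearMap.exact_subtype_mkQ J)
  mono_f := (ModuleCat.mono_iff_injective _).mpr J.injective_subtype
  epi_g := (ModuleCat.epi_iff_surjective _).mpr J.mkQ_surjective

/-- An ideal `I` is a `w`-ideal iff it contains every `x` with `J x ⊆ I` for a GV-ideal `J`. -/
theorem isWModule_ideal_iff (I : Ideal R) :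
    IsWModule R I ↔ ∀ J : Ideal R, IsGVIdeal R J → ∀ x : R, (∀ j ∈ J, j * x ∈ I) → x ∈ I := by
  constructor
  · rintro ⟨-, hI⟩ J hJ x hx
    let f : J →ₗ[R] I := (LinearMap.toSpanSingleton R R x ∘ₗ J.subtype).codRestrict I
      (fun j => by simpa using hx j j.2)
    have := hI J hJ
    obtain ⟨e, he⟩ := Ext.contravariant_sequence_exact₁ (shortExact_quot J) (ModuleCat.of R I)
      (Ext.mk₀ (ModuleCat.ofHom f)) (add_zero 1) (Subsingleton.elim _ _)
    obtain ⟨g, rfl⟩ := Ext.homEquiv₀.symm.surjective e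
    have h1 : ModuleCat.ofHom J.subtype ≫ g = ModuleCat.ofHom f := by
      apply Ext.homEquiv₀.symm.injective
      simpa using he
    have h2 : x - (g.hom (1 : R) : I).1 = 0 := by
      refine hJ.eq_zero fun j hj => ?_
      have h3 := congrArg Subtype.val (LinearMap.congr_fun (congrArg ModuleCat.Hom.hom h1) ⟨j, hj⟩)
      have h4 : g.hom j = j • g.hom (1 : R) := by
        rw [← map_smul]; simp
      have h5 : ((g.hom j : I) : R) = j * x := h3
      rw [h4] at h5
      have h6 : j * (g.hom (1 : R) : I).1 = j * x := h5
      rw [mul_sub, h6, sub_self]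
    rw [sub_eq_zero.mp h2]
    exact (g.hom (1 : R) : I).2
  · intro h
    refine ⟨?_, fun J hJ => ⟨fun a b => ?_⟩⟩
    · rw [IsGVTorsionFree, eq_bot_iff]
      rintro ⟨x, hx⟩ hxt
      obtain ⟨J, hJ, hJx⟩ := (mem_torGV R).mp hxt
      have : x = 0 := hJ.eq_zero fun j hj => congrArg Subtype.val (hJx j hj)
      simpa using this
    · have key : ∀ e : ExtR R (R ⧸ J) I 1, e = 0 := by
        intro e
        have : Projective (ModuleCat.shortComplexOfCompEqZero J.subtype J.mkQ
            (LinearMap.exact_subtype_mkQ J).linearMap_comp_eq_zero).X₂ :=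
          ModuleCat.projective_of_free (Module.Basis.singleton Unit R)
        obtain ⟨f', rfl⟩ := Ext.contravariant_sequence_exact₃ (shortExact_quot J)
          (ModuleCat.of R I) e (Ext.eq_zero_of_projective _) (add_zero 1)
        obtain ⟨f, rfl⟩ := Ext.homEquiv₀.symm.surjective f'
        obtain ⟨r, hr⟩ := hJ.exists_mul (I.subtype ∘ₗ f.hom)
        have hrI : r ∈ I := h J hJ r fun j hj => by
          rw [← hr ⟨j, hj⟩]; exact (f.hom ⟨j, hj⟩ : I).2
        have hf : f = ModuleCat.ofHom J.subtype ≫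
            ModuleCat.ofHom (LinearMap.toSpanSingleton R I ⟨r, hrI⟩) := by
          ext j
          exact hr j
        have : Ext.homEquiv₀.symm f = (Ext.mk₀ (ModuleCat.ofHom J.subtype)).comp
            (Ext.mk₀ (ModuleCat.ofHom (LinearMap.toSpanSingleton R I ⟨r, hrI⟩)))
            (zero_add 0) := by
          rw [Ext.mk₀_comp_mk₀, ← hf]; rfl
        rw [this]
        exact (shortExact_quot J).extClass_comp_assoc _
      rw [key a, key b]

/-- Maximal `w`-ideals are prime. -/
theorem IsMaximalWIdeal.isPrime {m : Ideal R} (hm : IsMaximalWIdeal R m) : m.IsPrime := by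
  refine ⟨hm.prop.1, fun {a b} hab => or_iff_not_imp_left.mpr fun ha => ?_⟩
  have hw := (isWModule_ideal_iff m).mp hm.prop.2
  let I : Ideal R := Submodule.comap (LinearMap.toSpanSingleton R R a) m
  have hI : ∀ x, x ∈ I ↔ x * a ∈ m := fun x => Iff.rfl
  have h1 : I ≠ ⊤ ∧ IsWModule R I := by
    refine ⟨fun h => ha ?_, (isWModule_ideal_iff I).mpr fun J hJ x hx => ?_⟩
    · have : (1 : R) ∈ I := h ▸ trivial
      simpa [hI] using this
    · rw [hI]
      refine hw J hJ _ fun j hj => ?_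
      rw [← mul_assoc]
      exact hx j hj
  refine hm.le_of_ge h1 (fun x hx => m.mul_mem_right a hx) ?_
  rw [hI, mul_comm]
  exact hab

end WModule

section WExact

variable {R : Type u} [CommRing R]
variable {A B C : Type*} [AddCommGroup A] [Module R A] [AddCommGroup B] [Module R B]
  [AddCommGroup C] [Module R C]

/-- The localization `f_m : A_m → B_m` of a linear map at a prime ideal `m`. -/
noncomputable def locMap (m : Ideal R) (hm : m.IsPrime) (f : A →ₗ[R] B) :
    LocalizedModule m.primeCompl A →ₗ[Localization m.primeCompl]
      LocalizedModule m.primeCompl B :=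
  LocalizedModule.map m.primeCompl f

/-- `0 → A → B → C → 0` is `w`-exact: `0 → A_m → B_m → C_m → 0` is exact for every maximal
`w`-ideal `m`. -/
def IsWShortExact (f : A →ₗ[R] B) (g : B →ₗ[R] C) : Prop :=
  ∀ (m : Ideal R) (hm : IsMaximalWIdeal R m),
    Function.Injective (locMap m hm.isPrime f) ∧
    Function.Exact (locMap m hm.isPrime f) (locMap m hm.isPrime g) ∧
    Function.Surjective (locMap m hm.isPrime g)

end WExact

section InjectiveHull

variable {R : Type u} [CommRing R]

/-- `i : M → E` is an injective hull: an essential embedding into an injective module. -/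
def IsInjectiveHull {M E : Type u} [AddCommGroup M] [Module R M] [AddCommGroup E] [Module R E]
    (i : M →ₗ[R] E) : Prop :=
  Function.Injective i ∧ Module.Injective R E ∧
    ∀ K : Submodule R E, K ⊓ LinearMap.range i = ⊥ → K = ⊥

variable (R)

/-- Every module has an injective hull. -/
theorem exists_isInjectiveHull (M : Type u) [AddCommGroup M] [Module R M] :
    ∃ (E : ModuleCat.{u} R) (i : M →ₗ[R] E), IsInjectiveHull i := by
  let P : InjectivePresentation (ModuleCat.of R M) := (EnoughInjectives.presentation _).some
  let I : Type u := P.J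
  let i₀ : M →ₗ[R] I := P.f.hom
  have hi₀ : Function.Injective i₀ := (ModuleCat.mono_iff_injective P.f).mp inferInstance
  have hI : Module.Injective R I :=
    @Module.injective_module_of_injective_object R I _ _ _ P.injective
  let S : Set (Submodule R I) := {E | LinearMap.range i₀ ≤ E ∧
    ∀ K ≤ E, K ⊓ LinearMap.range i₀ = ⊥ → K = ⊥}
  obtain ⟨E, -, hE⟩ := zorn_le_nonempty₀ S (by
    intro c hc hchain y hy
    refine ⟨sSup c, ⟨(hc hy).1.trans (le_sSup hy), fun K hK hK0 => ?_⟩, fun z hz => le_sSup hz⟩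
    rw [eq_bot_iff]
    intro x hx
    obtain ⟨F, hF, hxF⟩ :=
      (Submodule.mem_sSup_of_directed ⟨y, hy⟩ hchain.directedOn).mp (hK hx)
    have h1 := (hc hF).2 (Submodule.span R {x}) ((Submodule.span_singleton_le_iff_mem _ _).mpr hxF)
      (le_bot_iff.mp ((inf_le_inf_right _
        ((Submodule.span_singleton_le_iff_mem _ _).mpr hx)).trans hK0.le))
    rw [← h1]
    exact Submodule.mem_span_singleton_self x) (LinearMap.range i₀)
    ⟨le_rfl, fun K hK hK0 => by rwa [inf_eq_left.mpr hK] at hK0⟩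
  let D : Set (Submodule R I) := {K | K ⊓ E = ⊥}
  obtain ⟨K, -, hK⟩ := zorn_le_nonempty₀ D (by
    intro c hc hchain y hy
    refine ⟨sSup c, ?_, fun z hz => le_sSup hz⟩
    change sSup c ⊓ E = ⊥
    rw [eq_bot_iff]
    rintro x ⟨hx, hxE⟩
    obtain ⟨F, hF, hxF⟩ := (Submodule.mem_sSup_of_directed ⟨y, hy⟩ hchain.directedOn).mp hx
    have hF0 : F ⊓ E = ⊥ := hc hF
    rw [← hF0]
    exact ⟨hxF, hxE⟩) ⊥ (show ⊥ ⊓ E = ⊥ from bot_inf_eq E)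
  have hKE : K ⊓ E = ⊥ := hK.prop
  have hmax : ∀ T : Submodule R I, K ≤ T → T ⊓ E = ⊥ → T ≤ K := fun T hT hT0 =>
    hK.le_of_ge hT0 hT
  obtain ⟨h, hh⟩ := hI.out (K.mkQ ∘ₗ E.subtype) (by
    rw [← LinearMap.ker_eq_bot, eq_bot_iff]
    rintro ⟨e, he⟩ hz
    have h1 : e ∈ K := by simpa using hz
    have h2 : e ∈ K ⊓ E := ⟨h1, he⟩
    rw [hKE] at h2
    simpa using h2) E.subtype
  let r : I →ₗ[R] I := h ∘ₗ K.mkQ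
  have hrE : ∀ e ∈ E, r e = e := fun e he => hh ⟨e, he⟩
  have hrK : ∀ k ∈ K, r k = 0 := fun k hk => by
    have : K.mkQ k = 0 := by simpa using hk
    change h (K.mkQ k) = 0
    rw [this, map_zero]
  have hE' : LinearMap.range r ∈ S := by
    refine ⟨fun x hx => ⟨x, hrE x (hE.prop.1 hx)⟩, fun K' hK' hK0 => ?_⟩
    have h1 : K' ⊓ E = ⊥ := hE.prop.2 _ inf_le_right
      (le_bot_iff.mp ((inf_le_inf_right _ inf_le_left).trans hK0.le))
    have h2 : K'.comap r ≤ K := hmax _ (fun k hk => by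
        rw [Submodule.mem_comap, hrK k hk]; exact K'.zero_mem) (by
      rw [eq_bot_iff]
      rintro e ⟨he1, he2⟩
      rw [← h1]
      refine ⟨?_, he2⟩
      have : r e ∈ K' := he1
      rwa [hrE e he2] at this)
    rw [eq_bot_iff]
    intro y hy
    obtain ⟨x, rfl⟩ := hK' hy
    simpa using hrK x (h2 hy)
  have hrange : LinearMap.range r ≤ E := hE.le_of_ge hE' fun e he => ⟨e, hrE e he⟩
  refine ⟨ModuleCat.of R E, i₀.codRestrict E fun x => hE.prop.1 ⟨x, rfl⟩, ?_, ⟨?_⟩, ?_⟩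
  · exact fun a b hab => hi₀ (congrArg Subtype.val hab)
  · intro X Y _ _ _ _ f hf g
    obtain ⟨g', hg'⟩ := hI.out f hf (E.subtype ∘ₗ g)
    refine ⟨(r ∘ₗ g').codRestrict E fun y => hrange ⟨_, rfl⟩, fun x => ?_⟩
    apply Subtype.ext
    change r (g' (f x)) = _
    rw [hg']
    exact hrE _ (g x).2
  · intro L hL
    have h1 := hE.prop.2 (L.map E.subtype) (Submodule.map_subtype_le E L) (by
      rw [eq_bot_iff]
      rintro x ⟨⟨l, hl, rfl⟩, ⟨m, hm⟩⟩
      have h2 : l ∈ L ⊓ LinearMap.range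
          (i₀.codRestrict E fun x => hE.prop.1 ⟨x, rfl⟩) := ⟨hl, m, Subtype.ext hm⟩
      have h3 := hL.le h2
      have h4 : l = 0 := h3
      rw [h4]; simp)
    exact Submodule.map_injective_of_injective E.injective_subtype (by rw [h1, Submodule.map_bot])

/-- The injective hull `E(M)`. -/
noncomputable def InjHull (M : Type u) [AddCommGroup M] [Module R M] : ModuleCat.{u} R :=
  (exists_isInjectiveHull R M).choose

/-- The embedding `M → E(M)`. -/
noncomputable def injHullMap (M : Type u) [AddCommGroup M] [Module R M] : M →ₗ[R] InjHull R M :=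
  (exists_isInjectiveHull R M).choose_spec.choose

theorem isInjectiveHull_injHullMap (M : Type u) [AddCommGroup M] [Module R M] :
    IsInjectiveHull (injHullMap R M) :=
  (exists_isInjectiveHull R M).choose_spec.choose_spec

/-- The `w`-envelope `M_w = {x ∈ E(M) | J x ⊆ M for some GV-ideal J}` of a GV-torsion-free
module `M`. -/
noncomputable def wEnvelope (M : Type u) [AddCommGroup M] [Module R M] :
    Submodule R (InjHull R M) :=
  gvClosure R (LinearMap.range (injHullMap R M))

end InjectiveHull

section Classes

variable (R : Type u) [CommRing R] (M : Type u) [AddCommGroup M] [Module R M]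

/-- `L(M) = (M / tor_GV(M))_w`. -/
noncomputable abbrev LMod : Type u := wEnvelope R (M ⧸ torGV R M)

/-- `M` is `w`-projective: `Ext^1_R(L(M), N)` is GV-torsion for all torsion-free `w`-modules `N`. -/
def IsWProjective : Prop :=
  ∀ (N : Type u) [AddCommGroup N] [Module R N],
    Module.IsTorsionFree R N → IsWModule R N → IsGVTorsion R (ExtR R (LMod R M) N 1)

/-- `M` is `w`-split: `Ext^1_R(M, N)` is GV-torsion for all modules `N`. -/
def IsWSplit : Prop :=
  ∀ (N : Type u) [AddCommGroup N] [Module R N], IsGVTorsion R (ExtR R M N 1)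

/-- The class of GV-torsion-free modules `N` such that `Ext^k_R(P, N) = 0` for all `w`-projective
modules `P` and all `k ≥ 1`. -/
def InPwDagger (N : Type u) [AddCommGroup N] [Module R N] : Prop :=
  IsGVTorsionFree R N ∧
    ∀ (P : Type u) [AddCommGroup P] [Module R P], IsWProjective R P →
      ∀ k : ℕ, 1 ≤ k → Subsingleton (ExtR R P N k)

/-- `M` is weak `w`-projective: `Ext^1_R(M, N) = 0` for all `N` in the class above. -/
def IsWeakWProjective : Prop :=
  ∀ (N : Type u) [AddCommGroup N] [Module R N],
    InPwDagger R N → Subsingleton (ExtR R M N 1)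

end Classes

end WOp

namespace WOp

open CategoryTheory CategoryTheory.Abelian

/-! ### GV-closure of submodules, GV-torsion and GV-torsion-free modules -/

section Closure

variable {R : Type u} [CommRing R] {M : Type*} [AddCommGroup M] [Module R M]

/-! Take a surjection π from a finite free module F onto M; its kernel K is finitely generated. The
conditions are compared through `liftIdeal π`, the ideal of those s for which s·id_M factors through
π. A GV-ideal inside it annihilates every Ext¹(M, N), because Ext¹(F, N) = 0; conversely, a GV-ideal
killing the class of 0 → K → F → M → 0 lies inside it. An ideal contained in no maximal w-ideal
contains a GV-ideal (`exists_isGVIdeal_le`), so M is w-split as soon as `liftIdeal π` contains some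
s ∉ m for each maximal w-ideal m.

Condition 3, applied to this sequence and to id_M, yields such an s. In return, a GV-ideal in
`liftIdeal π` has an element outside m, and with it maps out of M lift locally through the
projective F (`IsWShortExact.compRight`).

For condition 2 the test module is K_m. Every module N on which the elements outside m act
bijectively lies in the class defining weak w-projectivity (`IsLocalAt.inPwDagger`): for
w-projective P a GV-ideal kills Ext^k(L(P), N), yet its elements outside m act injectively there;
and P differs from L(P) only by GV-torsion modules, whose Ext into N vanishes. Hence Ext¹(M, K_m) =
0, so K → K_m extends to F, and clearing denominators gives s
(`exists_mem_liftIdeal_of_ext_subsingleton`). Finally, w-split modules are w-projective, so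
condition 1 gives condition 2 directly. -/

theorem le_gvClosure (N : Submodule R M) : N ≤ gvClosure R N :=
  fun _ hx => ⟨⊤, isGVIdeal_top, fun j _ => N.smul_mem j hx⟩

/-- A finitely generated submodule of the closure of `N` is multiplied into `N` by a single
GV-ideal. -/
theorem exists_isGVIdeal_smul_mem {N P : Submodule R M} (hP : P.FG) (h : P ≤ gvClosure R N) :
    ∃ J : Ideal R, IsGVIdeal R J ∧ ∀ j ∈ J, ∀ p ∈ P, j • p ∈ N := by
  induction P, hP using Submodule.fg_induction with
  | singleton x =>
    obtain ⟨J, hJ, hx⟩ := h (Submodule.mem_span_singleton_self x)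
    refine ⟨J, hJ, fun j hj p hp => ?_⟩
    obtain ⟨r, rfl⟩ := Submodule.mem_span_singleton.mp hp
    rw [smul_comm]
    exact N.smul_mem r (hx j hj)
  | sup P Q _ _ hP hQ =>
    obtain ⟨I, hI, hI'⟩ := hP (le_sup_left.trans h)
    obtain ⟨J, hJ, hJ'⟩ := hQ (le_sup_right.trans h)
    refine ⟨I * J, hI.mul hJ, fun k hk x hx => ?_⟩
    obtain ⟨p, hp, q, hq, rfl⟩ := Submodule.mem_sup.mp hx
    rw [smul_add]
    exact N.add_mem (hI' k (Ideal.mul_le_left hk) p hp) (hJ' k (Ideal.mul_le_right hk) q hq)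

/-- The closure is idempotent: J is finitely generated, so one GV-ideal I carries all of Jx into N,
and IJ is again a GV-ideal. -/
theorem mem_gvClosure_of_smul_mem {N : Submodule R M} {J : Ideal R} (hJ : IsGVIdeal R J) {x : M}
    (h : ∀ j ∈ J, j • x ∈ gvClosure R N) : x ∈ gvClosure R N := by
  obtain ⟨I, hI, hI'⟩ := exists_isGVIdeal_smul_mem
    (P := Submodule.map (LinearMap.toSpanSingleton R M x) J) (Submodule.FG.map _ hJ.1) (by
      rintro _ ⟨j, hj, rfl⟩
      exact h j hj)
  refine ⟨I * J, hI.mul hJ, fun k hk => ?_⟩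
  induction hk using Submodule.mul_induction_on' with
  | mem_mul_mem i hi j hj =>
    rw [mul_smul]
    exact hI' i hi _ ⟨j, hj, rfl⟩
  | add a _ b _ ha hb =>
    rw [add_smul]
    exact N.add_mem ha hb

theorem isGVTorsionFree_iff :
    IsGVTorsionFree R M ↔ ∀ J : Ideal R, IsGVIdeal R J → ∀ x : M, (∀ j ∈ J, j • x = 0) → x = 0 := by
  rw [IsGVTorsionFree, eq_bot_iff]
  exact ⟨fun h J hJ x hx => h ⟨J, hJ, hx⟩, fun h x ⟨J, hJ, hx⟩ => h J hJ x hx⟩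

theorem isGVTorsion_iff :
    IsGVTorsion R M ↔ ∀ x : M, ∃ J : Ideal R, IsGVIdeal R J ∧ ∀ j ∈ J, j • x = 0 :=
  Submodule.eq_top_iff'

theorem IsGVTorsionFree.of_injective {N : Type*} [AddCommGroup N] [Module R N]
    (hN : IsGVTorsionFree R N) (f : M →ₗ[R] N) (hf : Function.Injective f) :
    IsGVTorsionFree R M := by
  rw [isGVTorsionFree_iff] at hN ⊢
  refine fun J hJ x hx => hf ?_
  rw [map_zero]
  exact hN J hJ _ fun j hj => by rw [← map_smul, hx j hj, map_zero]

theorem IsGVTorsion.of_injective {N : Type*} [AddCommGroup N] [Module R N]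
    (hN : IsGVTorsion R N) (f : M →ₗ[R] N) (hf : Function.Injective f) :
    IsGVTorsion R M := by
  rw [isGVTorsion_iff] at hN ⊢
  intro x
  obtain ⟨J, hJ, hx⟩ := hN (f x)
  refine ⟨J, hJ, fun j hj => hf ?_⟩
  rw [map_smul, hx j hj, map_zero]

theorem IsGVTorsion.linearMap_eq_zero {N : Type*} [AddCommGroup N] [Module R N]
    (hM : IsGVTorsion R M) (hN : IsGVTorsionFree R N) (f : M →ₗ[R] N) : f = 0 := by
  ext x
  obtain ⟨J, hJ, hx⟩ := isGVTorsion_iff.mp hM x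
  exact isGVTorsionFree_iff.mp hN J hJ _ fun j hj => by rw [← map_smul, hx j hj, map_zero]

theorem isGVTorsion_torGV : IsGVTorsion R (torGV R M) := by
  rw [isGVTorsion_iff]
  rintro ⟨x, J, hJ, hx⟩
  exact ⟨J, hJ, fun j hj => Subtype.ext (hx j hj)⟩

theorem isGVTorsionFree_quotient_torGV : IsGVTorsionFree R (M ⧸ torGV R M) := by
  rw [isGVTorsionFree_iff]
  intro J hJ x hx
  obtain ⟨x, rfl⟩ := Submodule.mkQ_surjective _ x
  simp only [Submodule.mkQ_apply, ← Submodule.Quotient.mk_smul,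
    Submodule.Quotient.mk_eq_zero] at hx ⊢
  exact mem_gvClosure_of_smul_mem hJ hx

theorem isGVTorsionFree_finsupp (ι : Type*) : IsGVTorsionFree R (ι →₀ R) := by
  rw [isGVTorsionFree_iff]
  intro J hJ x hx
  ext i
  exact hJ.eq_zero fun j hj => by simpa using DFunLike.congr_fun (hx j hj) i

end Closure

/-! ### Existence of maximal w-ideals and their relation to GV-ideals -/

section MaximalWIdeal

variable {R : Type u} [CommRing R]

theorem isWModule_gvClosure (I : Ideal R) : IsWModule R (gvClosure R I) :=
  (isWModule_ideal_iff _).mpr fun _ hJ _ hx => mem_gvClosure_of_smul_mem hJ hx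

theorem IsMaximalWIdeal.not_le {m : Ideal R} (hm : IsMaximalWIdeal R m) {J : Ideal R}
    (hJ : IsGVIdeal R J) : ¬ J ≤ m := fun h =>
  hm.prop.1 <| m.eq_top_iff_one.mpr <| (isWModule_ideal_iff m).mp hm.prop.2 J hJ 1
    fun j hj => by simpa using h hj

/-- Every proper `w`-ideal is contained in a maximal `w`-ideal. -/
theorem exists_le_isMaximalWIdeal {I : Ideal R} (hI : I ≠ ⊤) (hw : IsWModule R I) :
    ∃ m, IsMaximalWIdeal R m ∧ I ≤ m := by
  obtain ⟨m, hm, h⟩ := zorn_le_nonempty₀ {I : Ideal R | I ≠ ⊤ ∧ IsWModule R I} (by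
    intro c hc hchain y hy
    refine ⟨sSup c, ⟨fun h => ?_, (isWModule_ideal_iff _).mpr fun J hJ x hx => ?_⟩,
      fun z hz => le_sSup hz⟩
    · have h1 : (1 : R) ∈ sSup c := h ▸ trivial
      obtain ⟨K, hK, h1⟩ := (Submodule.mem_sSup_of_directed ⟨y, hy⟩ hchain.directedOn).mp h1
      exact (hc hK).1 (Ideal.eq_top_iff_one K |>.mpr h1)
    -- The ideal Jx is finitely generated, hence compact, so it already lies in one member of the
    -- chain.
    · have hfg : (Submodule.map (LinearMap.toSpanSingleton R R x) J).FG := Submodule.FG.map _ hJ.1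
      rw [Submodule.fg_iff_compact,
        CompleteLattice.isCompactElement_iff_le_of_directed_sSup_le] at hfg
      obtain ⟨K, hK, h⟩ := hfg c ⟨y, hy⟩ hchain.directedOn (by
        rintro _ ⟨j, hj, rfl⟩
        exact hx j hj)
      exact le_sSup hK ((isWModule_ideal_iff K).mp (hc hK).2 J hJ x fun j hj => h ⟨j, hj, rfl⟩))
    I ⟨hI, hw⟩
  exact ⟨m, h, hm⟩

/-- An ideal contained in no maximal `w`-ideal contains a GV-ideal. -/
theorem exists_isGVIdeal_le {I : Ideal R} (h : ∀ m, IsMaximalWIdeal R m → ¬ I ≤ m) :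
    ∃ J, IsGVIdeal R J ∧ J ≤ I := by
  have h1 : gvClosure R I = ⊤ := by
    by_contra hI
    obtain ⟨m, hm, hle⟩ := exists_le_isMaximalWIdeal hI (isWModule_gvClosure I)
    exact h m hm ((le_gvClosure I).trans hle)
  obtain ⟨J, hJ, hJI⟩ := (h1 ▸ trivial : (1 : R) ∈ gvClosure R I)
  exact ⟨J, hJ, fun j hj => by simpa using hJI j hj⟩

end MaximalWIdeal

/-! ### Modules local at a prime -/

section LocalAt

variable {R : Type u} [CommRing R]

/-- Every element outside `m` acts bijectively on `N`. -/
def IsLocalAt (m : Ideal R) (N : Type*) [AddCommGroup N] [Module R N] : Prop :=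
  ∀ s ∉ m, Function.Bijective fun x : N => s • x

variable {m : Ideal R} {N : Type*} [AddCommGroup N] [Module R N]

/-- A GV-ideal is not contained in m, so it has an element acting injectively on N. -/
theorem IsLocalAt.isGVTorsionFree (hm : IsMaximalWIdeal R m) (hN : IsLocalAt m N) :
    IsGVTorsionFree R N := by
  rw [isGVTorsionFree_iff]
  intro J hJ x hx
  obtain ⟨s, hs, hsm⟩ := SetLike.not_le_iff_exists.mp (hm.not_le hJ)
  refine (hN s hsm).1 ?_
  simp [hx s hs]

theorem IsLocalAt.of_isLocalizedModule [m.IsPrime] {K : Type*} [AddCommGroup K] [Module R K]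
    (f : K →ₗ[R] N) [IsLocalizedModule m.primeCompl f] : IsLocalAt m N := fun s hs =>
  (Module.End.isUnit_iff _).mp (IsLocalizedModule.map_units f (⟨s, hs⟩ : m.primeCompl))

theorem IsLocalAt.quotient (hN : IsLocalAt m N) {K : Submodule R N} (hK : IsLocalAt m K) :
    IsLocalAt m (N ⧸ K) := by
  refine fun s hs => ⟨(injective_iff_map_eq_zero
    (LinearMap.lsmul R (N ⧸ K) s)).mpr fun x hx => ?_, fun x => ?_⟩
  · obtain ⟨x, rfl⟩ := Submodule.mkQ_surjective _ x
    simp only [LinearMap.lsmul_apply, Submodule.mkQ_apply,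
      ← Submodule.Quotient.mk_smul, Submodule.Quotient.mk_eq_zero] at hx ⊢
    obtain ⟨k, hk⟩ := (hK s hs).2 ⟨_, hx⟩
    have : (k : N) = x := (hN s hs).1 (congrArg Subtype.val hk)
    exact this ▸ k.2
  · obtain ⟨x, rfl⟩ := Submodule.mkQ_surjective _ x
    obtain ⟨y, rfl⟩ := (hN s hs).2 x
    exact ⟨K.mkQ y, (map_smul _ _ _).symm⟩

theorem IsLocalAt.congr {N' : Type*} [AddCommGroup N'] [Module R N'] (hN : IsLocalAt m N)
    (e : N ≃ₗ[R] N') : IsLocalAt m N' := fun s hs => by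
  have : (fun x : N' => s • x) = e ∘ (fun x : N => s • x) ∘ e.symm := by
    ext x; simp
  rw [this]
  exact e.bijective.comp ((hN s hs).comp e.symm.bijective)

/-- An injective module over the localization of `R` is injective over `R`. -/
theorem injective_of_injective_localization (S : Submonoid R) (E : Type u) [AddCommGroup E]
    [Module R E] [Module (Localization S) E] [IsScalarTower R (Localization S) E]
    (hE : Module.Injective (Localization S) E) : Module.Injective R E where
  out X Y _ _ _ _ f hf g := by
    -- S acts invertibly on E, so g extends to the localization of X, where injectivity of E
    -- applies.
    have hu : ∀ s : S, IsUnit (algebraMap R (Module.End R E) s) :=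
      fun s => (isLocalizedModule_id S E (Localization S)).map_units s
    let g' : LocalizedModule S X →ₗ[Localization S] E :=
      LinearMap.extendScalarsOfIsLocalization S (Localization S) (LocalizedModule.lift S g hu)
    obtain ⟨h, hh⟩ := hE.out (LocalizedModule.map S f) (LocalizedModule.map_injective S f hf) g'
    refine ⟨h.restrictScalars R ∘ₗ LocalizedModule.mkLinearMap S Y, fun x => ?_⟩
    have h1 := hh (LocalizedModule.mkLinearMap S X x)
    simpa [g', LocalizedModule.mkLinearMap_apply, LocalizedModule.map_mk] using h1

end LocalAt

/-! ### Functoriality of Ext and vanishing from long exact sequences -/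

section ExtSequences

variable {R : Type u} [CommRing R] {A B C N X : Type u}
  [AddCommGroup A] [Module R A] [AddCommGroup B] [Module R B] [AddCommGroup C] [Module R C]
  [AddCommGroup N] [Module R N] [AddCommGroup X] [Module R X]

theorem shortExact_of_exact {f : A →ₗ[R] B} {g : B →ₗ[R] C} (hf : Function.Injective f)
    (hfg : Function.Exact f g) (hg : Function.Surjective g) :
    (ModuleCat.shortComplexOfCompEqZero f g hfg.linearMap_comp_eq_zero).ShortExact where
  exact := (ShortComplex.ShortExact.moduleCat_exact_iff_function_exact _).mpr hfg
  mono_f := (ModuleCat.mono_iff_injective _).mpr hf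
  epi_g := (ModuleCat.epi_iff_surjective _).mpr hg

/-- Pullback of extension classes along a linear map. -/
noncomputable def extPrecomp (f : A →ₗ[R] B) (N : Type u) [AddCommGroup N] [Module R N] (n : ℕ) :
    ExtR R B N n →ₗ[R] ExtR R A N n :=
  Ext.precompOfLinear (Ext.mk₀ (ModuleCat.ofHom f)) R _ (zero_add n)

/-- Pushforward of extension classes along a linear map. -/
noncomputable def extPostcomp (X : Type u) [AddCommGroup X] [Module R X] (f : A →ₗ[R] B) (n : ℕ) :
    ExtR R X A n →ₗ[R] ExtR R X B n :=
  Ext.postcompOfLinear (Ext.mk₀ (ModuleCat.ofHom f)) R _ (add_zero n)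

theorem extPrecomp_comp (f : A →ₗ[R] B) (g : B →ₗ[R] C) (n : ℕ) (e : ExtR R C N n) :
    extPrecomp f N n (extPrecomp g N n e) = extPrecomp (g ∘ₗ f) N n e := by
  simp [extPrecomp, ModuleCat.ofHom_comp]

theorem extPrecomp_smul_id (s : R) (n : ℕ) (e : ExtR R A N n) :
    extPrecomp (s • LinearMap.id : A →ₗ[R] A) N n e = s • e := by
  have : ModuleCat.ofHom (s • LinearMap.id : A →ₗ[R] A) = s • 𝟙 (ModuleCat.of R A) := rfl
  simp [extPrecomp, this, Ext.mk₀_smul]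

theorem extPostcomp_comp (f : A →ₗ[R] B) (g : B →ₗ[R] C) (n : ℕ) (e : ExtR R X A n) :
    extPostcomp X g n (extPostcomp X f n e) = extPostcomp X (g ∘ₗ f) n e := by
  simp [extPostcomp, ModuleCat.ofHom_comp]

theorem extPostcomp_smul_id (s : R) (n : ℕ) (e : ExtR R X A n) :
    extPostcomp X (s • LinearMap.id : A →ₗ[R] A) n e = s • e := by
  have : ModuleCat.ofHom (s • LinearMap.id : A →ₗ[R] A) = s • 𝟙 (ModuleCat.of R A) := rfl
  simp [extPostcomp, this, Ext.mk₀_smul]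

theorem ext_subsingleton_of_projective [Module.Projective R A] (n : ℕ) :
    Subsingleton (ExtR R A N (n + 1)) := by
  have : Projective (ModuleCat.of R A) := (IsProjective.iff_projective A).mp inferInstance
  exact subsingleton_of_forall_eq 0 fun e => Ext.eq_zero_of_projective e

theorem ext_subsingleton_of_injective [Module.Injective R N] (n : ℕ) :
    Subsingleton (ExtR R A N (n + 1)) := by
  have : Injective (ModuleCat.of R N) := Module.injective_object_of_injective_module R N
  exact subsingleton_of_forall_eq 0 fun e => Ext.eq_zero_of_injective e

theorem ext_zero_subsingleton (h : ∀ f : A →ₗ[R] N, f = 0) : Subsingleton (ExtR R A N 0) :=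
  have : Subsingleton (ModuleCat.of R A ⟶ ModuleCat.of R N) :=
    subsingleton_of_forall_eq 0 fun f => ModuleCat.hom_ext (h f.hom)
  Ext.homEquiv₀.subsingleton

section

variable {f : A →ₗ[R] B} {g : B →ₗ[R] C} (hf : Function.Injective f)
  (hfg : Function.Exact f g) (hg : Function.Surjective g)

include hf hfg hg

theorem ext_subsingleton_middle (n : ℕ) (hA : Subsingleton (ExtR R A N n))
    (hC : Subsingleton (ExtR R C N n)) : Subsingleton (ExtR R B N n) :=
  subsingleton_of_forall_eq 0 fun e => by
    obtain ⟨e', rfl⟩ := Ext.contravariant_sequence_exact₂ (shortExact_of_exact hf hfg hg)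
      (ModuleCat.of R N) e (Subsingleton.elim (α := ExtR R A N n) _ _)
    rw [Subsingleton.elim (α := ExtR R C N n) e' 0, Ext.comp_zero]

theorem ext_subsingleton_left (n : ℕ) (hB : Subsingleton (ExtR R B N n))
    (hC : Subsingleton (ExtR R C N (n + 1))) : Subsingleton (ExtR R A N n) :=
  subsingleton_of_forall_eq 0 fun e => by
    obtain ⟨e', rfl⟩ := Ext.contravariant_sequence_exact₁ (shortExact_of_exact hf hfg hg)
      (ModuleCat.of R N) e (add_comm 1 n) (Subsingleton.elim (α := ExtR R C N (n + 1)) _ _)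
    rw [Subsingleton.elim (α := ExtR R B N n) e' 0, Ext.comp_zero]

theorem ext_subsingleton_shift (n : ℕ) (hC : Subsingleton (ExtR R X C n))
    (hB : Subsingleton (ExtR R X B (n + 1))) : Subsingleton (ExtR R X A (n + 1)) :=
  subsingleton_of_forall_eq 0 fun e => by
    obtain ⟨e', rfl⟩ := Ext.covariant_sequence_exact₁ (ModuleCat.of R X)
      (shortExact_of_exact hf hfg hg) e (Subsingleton.elim (α := ExtR R X B (n + 1)) _ _) rfl
    rw [Subsingleton.elim (α := ExtR R X C n) e' 0, Ext.zero_comp]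

theorem extPrecomp_injective_of_left (n : ℕ) (hA : Subsingleton (ExtR R A N n)) :
    Function.Injective (extPrecomp g N (n + 1)) := by
  refine (injective_iff_map_eq_zero _).mpr fun e he => ?_
  obtain ⟨e', rfl⟩ := Ext.contravariant_sequence_exact₃ (shortExact_of_exact hf hfg hg)
    (ModuleCat.of R N) e he (add_comm 1 n)
  rw [Subsingleton.elim (α := ExtR R A N n) e' 0, Ext.comp_zero]

theorem extPrecomp_injective_of_right (n : ℕ) (hC : Subsingleton (ExtR R C N n)) :
    Function.Injective (extPrecomp f N n) := by
  refine (injective_iff_map_eq_zero _).mpr fun e he => ?_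
  obtain ⟨e', rfl⟩ := Ext.contravariant_sequence_exact₂ (shortExact_of_exact hf hfg hg)
    (ModuleCat.of R N) e he
  rw [Subsingleton.elim (α := ExtR R C N n) e' 0, Ext.comp_zero]

/-- A map out of `A` extends to `B` if `Ext¹(C, N) = 0`. -/
theorem exists_extension_of_ext_subsingleton (hC : Subsingleton (ExtR R C N 1)) (φ : A →ₗ[R] N) :
    ∃ ψ : B →ₗ[R] N, ψ ∘ₗ f = φ := by
  obtain ⟨e, he⟩ := Ext.contravariant_sequence_exact₁ (shortExact_of_exact hf hfg hg)
    (ModuleCat.of R N) (Ext.mk₀ (ModuleCat.ofHom φ)) (add_zero 1)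
    (Subsingleton.elim (α := ExtR R C N 1) _ _)
  obtain ⟨ψ, rfl⟩ := Ext.homEquiv₀.symm.surjective e
  refine ⟨ψ.hom, ?_⟩
  have h1 : ModuleCat.ofHom f ≫ ψ = ModuleCat.ofHom φ := by
    apply Ext.homEquiv₀.symm.injective
    simpa using he
  exact congrArg ModuleCat.Hom.hom h1

/-- `Ext¹(C, N) = 0` if all maps out of `A` extend to the projective module `B`. -/
theorem ext_one_subsingleton_of_extension [Module.Projective R B]
    (h : ∀ φ : A →ₗ[R] N, ∃ ψ : B →ₗ[R] N, ψ ∘ₗ f = φ) : Subsingleton (ExtR R C N 1) :=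
  subsingleton_of_forall_eq 0 fun e => by
    have := ext_subsingleton_of_projective (R := R) (A := B) (N := N) 0
    obtain ⟨φ', rfl⟩ := Ext.contravariant_sequence_exact₃ (shortExact_of_exact hf hfg hg)
      (ModuleCat.of R N) e (Subsingleton.elim (α := ExtR R B N 1) _ _) (add_zero 1)
    obtain ⟨φ, rfl⟩ := Ext.homEquiv₀.symm.surjective φ'
    obtain ⟨ψ, hψ⟩ := h φ.hom
    have : Ext.homEquiv₀.symm φ = (Ext.mk₀ (ModuleCat.ofHom f)).comp
        (Ext.mk₀ (ModuleCat.ofHom ψ)) (zero_add 0) := by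
      rw [Ext.mk₀_comp_mk₀, ← ModuleCat.ofHom_comp, hψ]; rfl
    rw [this]
    exact (shortExact_of_exact hf hfg hg).extClass_comp_assoc _

/-- `Ext¹(X, A)` is covered by `Hom(X, C)` if `Ext¹(X, B) = 0`. -/
theorem ext_one_subsingleton_of_injective_middle [Module.Injective R B]
    (h : ∀ φ : X →ₗ[R] C, φ = 0) : Subsingleton (ExtR R X A 1) :=
  ext_subsingleton_shift hf hfg hg 0 (ext_zero_subsingleton h) (ext_subsingleton_of_injective 0)

end

end ExtSequences

/-! ### The lift ideal of a map onto M -/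

section LiftIdeal

variable {R : Type u} [CommRing R]

/-- The ideal of all `s` such that `s • id_M` factors through `g : F → M`. -/
def liftIdeal {F M : Type*} [AddCommGroup F] [Module R F] [AddCommGroup M] [Module R M]
    (g : F →ₗ[R] M) : Ideal R :=
  (LinearMap.range (g.compRight R : (M →ₗ[R] F) →ₗ[R] (M →ₗ[R] M))).comap
    (LinearMap.toSpanSingleton R (M →ₗ[R] M) LinearMap.id)

variable {F M N : Type u} [AddCommGroup F] [Module R F] [AddCommGroup M] [Module R M]
  [AddCommGroup N] [Module R N]

theorem mem_liftIdeal {g : F →ₗ[R] M} {s : R} :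
    s ∈ liftIdeal g ↔ ∃ h : M →ₗ[R] F, g ∘ₗ h = s • LinearMap.id :=
  Iff.rfl

/-- Multiplication by s on Ext(M, N) factors through Ext(F, N), which vanishes in positive degree.
-/
theorem smul_ext_eq_zero_of_mem_liftIdeal [Module.Projective R F] {g : F →ₗ[R] M} {s : R}
    (hs : s ∈ liftIdeal g) (n : ℕ) (e : ExtR R M N (n + 1)) : s • e = 0 := by
  obtain ⟨h, hh⟩ := mem_liftIdeal.mp hs
  have := ext_subsingleton_of_projective (R := R) (A := F) (N := N) n
  rw [← extPrecomp_smul_id, ← hh, ← extPrecomp_comp, Subsingleton.elim (extPrecomp g N _ e) 0,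
    map_zero]

theorem isWSplit_of_isGVIdeal_le_liftIdeal [Module.Projective R F] {g : F →ₗ[R] M} {J : Ideal R}
    (hJ : IsGVIdeal R J) (hle : J ≤ liftIdeal g) : IsWSplit R M := fun _ _ _ =>
  isGVTorsion_iff.mpr fun e =>
    ⟨J, hJ, fun _ hj => smul_ext_eq_zero_of_mem_liftIdeal (hle hj) 0 e⟩

/-- Some GV-ideal kills the class of 0 → ker g → F → M → 0. The class is the obstruction to lifting
id_M along g, and s times it is the obstruction to lifting s·id_M. -/
theorem exists_isGVIdeal_le_liftIdeal {g : F →ₗ[R] M} (hg : Function.Surjective g)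
    (h : IsGVTorsion R (ExtR R M (LinearMap.ker g) 1)) :
    ∃ J : Ideal R, IsGVIdeal R J ∧ J ≤ liftIdeal g := by
  have hS := shortExact_of_exact (LinearMap.ker g).injective_subtype
    (LinearMap.exact_subtype_ker_map g) hg
  obtain ⟨J, hJ, hJ0⟩ := isGVTorsion_iff.mp h hS.extClass
  refine ⟨J, hJ, fun s hs => mem_liftIdeal.mpr ?_⟩
  have h1 : (Ext.mk₀ (s • 𝟙 (ModuleCat.of R M))).comp hS.extClass (zero_add 1) = 0 := by
    rw [Ext.mk₀_smul, Ext.smul_comp]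
    exact (congrArg (s • ·) (Ext.mk₀_id_comp _)).trans (hJ0 s hs)
  obtain ⟨e, he⟩ := Ext.covariant_sequence_exact₃ (ModuleCat.of R M) hS _ (zero_add 1) h1
  obtain ⟨φ, rfl⟩ := Ext.homEquiv₀.symm.surjective e
  refine ⟨φ.hom, ?_⟩
  have h2 : φ ≫ ModuleCat.ofHom g = s • 𝟙 (ModuleCat.of R M) := by
    apply Ext.homEquiv₀.symm.injective
    simpa using he
  exact congrArg ModuleCat.Hom.hom h2

end LiftIdeal

/-! ### w-modules: free modules, kernels, and Ext from GV-torsion modules -/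

section WModules

variable {R : Type u} [CommRing R]

/-- Since R is projective, Ext¹(R/J, N) is the obstruction to extending maps J → N to R, and a map R
→ N is determined by the image of 1. -/
theorem isWModule_iff {N : Type u} [AddCommGroup N] [Module R N] :
    IsWModule R N ↔ IsGVTorsionFree R N ∧ ∀ J : Ideal R, IsGVIdeal R J →
      ∀ φ : J →ₗ[R] N, ∃ n : N, ∀ j : J, φ j = (j : R) • n := by
  refine and_congr_right fun _ => forall₂_congr fun J _ => ⟨fun h φ => ?_, fun h => ?_⟩
  · obtain ⟨ψ, rfl⟩ := exists_extension_of_ext_subsingleton J.injective_subtype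
      (LinearMap.exact_subtype_mkQ J) J.mkQ_surjective h φ
    refine ⟨ψ 1, fun j => ?_⟩
    rw [← map_smul, smul_eq_mul, mul_one]
    rfl
  · refine ext_one_subsingleton_of_extension J.injective_subtype
      (LinearMap.exact_subtype_mkQ J) J.mkQ_surjective fun φ => ?_
    obtain ⟨n, hn⟩ := h φ
    exact ⟨LinearMap.toSpanSingleton R N n, LinearMap.ext fun j => (hn j).symm⟩

/-- Each coordinate of a map out of J is multiplication by some r i; finite generation of J leaves
only finitely many nonzero r i. -/
theorem isWModule_finsupp (ι : Type u) : IsWModule R (ι →₀ R) := by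
  refine isWModule_iff.mpr ⟨isGVTorsionFree_finsupp ι, fun J hJ φ => ?_⟩
  choose r hr using fun i => hJ.exists_mul (Finsupp.lapply i ∘ₗ φ)
  obtain ⟨s, hs⟩ := hJ.1
  classical
  have hsJ : ∀ x ∈ s, x ∈ J := fun x hx => hs ▸ Submodule.subset_span hx
  -- Outside the supports of the images of the generators, r i is killed by all of J, hence is zero.
  have hfin : (Function.support r).Finite := by
    refine (s.attach.biUnion fun x => (φ ⟨x, hsJ x x.2⟩).support).finite_toSet.subset
      fun i hi => ?_
    by_contra hi'
    simp only [Finset.coe_biUnion, Set.mem_iUnion, not_exists, Finset.mem_coe,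
      Finsupp.mem_support_iff, not_not] at hi'
    refine hi (hJ.eq_zero fun j hj => ?_)
    rw [← hs] at hj
    induction hj using Submodule.span_induction with
    | mem x hx =>
      rw [← hr i ⟨x, hsJ x hx⟩]
      exact hi' ⟨x, hx⟩ (Finset.mem_attach _ _)
    | zero => rw [zero_mul]
    | add x y _ _ hx hy => rw [add_mul, hx, hy, add_zero]
    | smul a x _ hx => rw [smul_eq_mul, mul_assoc, hx, mul_zero]
  refine ⟨Finsupp.ofSupportFinite r hfin, fun j => ?_⟩
  ext i
  exact hr i j

/-- The kernel of a map from a `w`-module to a GV-torsion-free module is a `w`-module. -/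
theorem IsWModule.ker {F L : Type u} [AddCommGroup F] [Module R F] [AddCommGroup L] [Module R L]
    (hF : IsWModule R F) (hL : IsGVTorsionFree R L) (g : F →ₗ[R] L) :
    IsWModule R (LinearMap.ker g) := by
  refine isWModule_iff.mpr ⟨hF.1.of_injective _ (LinearMap.ker g).injective_subtype,
    fun J hJ φ => ?_⟩
  obtain ⟨y, hy⟩ := (isWModule_iff.mp hF).2 J hJ ((LinearMap.ker g).subtype ∘ₗ φ)
  refine ⟨⟨y, isGVTorsionFree_iff.mp hL J hJ _ fun j hj => ?_⟩, fun j => Subtype.ext (hy j)⟩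
  rw [← map_smul, ← hy ⟨j, hj⟩]
  exact (φ ⟨j, hj⟩).2

/-- The GV-torsion of E meets the image of M trivially, and the embedding is essential. -/
theorem IsInjectiveHull.isGVTorsionFree {M E : Type u} [AddCommGroup M] [Module R M]
    [AddCommGroup E] [Module R E] {i : M →ₗ[R] E} (hi : IsInjectiveHull i)
    (hM : IsGVTorsionFree R M) : IsGVTorsionFree R E := by
  refine hi.2.2 _ ((Submodule.eq_bot_iff _).mpr ?_)
  rintro _ ⟨⟨J, hJ, hx⟩, x, rfl⟩
  rw [isGVTorsionFree_iff.mp hM J hJ x fun j hj => hi.1 ?_, map_zero]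
  rw [map_smul, map_zero]
  exact hx j hj

/-- E(N)/N is GV-torsion-free because N is a w-module, so Hom(Q, E(N)/N) = 0; this group surjects
onto Ext¹(Q, N). -/
theorem IsWModule.ext_one_subsingleton {Q N : Type u} [AddCommGroup Q] [Module R Q]
    [AddCommGroup N] [Module R N] (hQ : IsGVTorsion R Q) (hN : IsWModule R N) :
    Subsingleton (ExtR R Q N 1) := by
  have hi := isInjectiveHull_injHullMap R N
  have := hi.2.1
  have hE := isGVTorsionFree_iff.mp (hi.isGVTorsionFree hN.1)
  refine ext_one_subsingleton_of_injective_middle hi.1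
    (LinearMap.exact_map_mkQ_range (injHullMap R N)) (Submodule.mkQ_surjective _)
    (hQ.linearMap_eq_zero (isGVTorsionFree_iff.mpr fun J hJ y hy => ?_))
  obtain ⟨y, rfl⟩ := Submodule.mkQ_surjective _ y
  simp only [Submodule.mkQ_apply, ← Submodule.Quotient.mk_smul,
    Submodule.Quotient.mk_eq_zero] at hy ⊢
  let e := LinearEquiv.ofInjective _ hi.1
  -- If Jy ⊆ N, then j ↦ jy is multiplication by some n in N, and J kills n − y in the
  -- GV-torsion-free E(N).
  obtain ⟨n, hn⟩ := (isWModule_iff.mp hN).2 J hJ (e.symm.toLinearMap ∘ₗ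
    (LinearMap.toSpanSingleton R _ y ∘ₗ J.subtype).codRestrict _ fun j => hy j j.2)
  refine ⟨n, sub_eq_zero.mp (hE J hJ _ fun j hj => ?_)⟩
  have h1 := e.symm_apply_eq.mp (hn ⟨j, hj⟩)
  have h2 : j • y = j • injHullMap R N n :=
    (congrArg Subtype.val h1).trans (by rw [map_smul]; rfl)
  rw [smul_sub, h2, sub_self]

end WModules

/-! ### The w-envelope, and w-split versus w-projective modules -/

section Envelope

variable (R : Type u) [CommRing R] (M : Type u) [AddCommGroup M] [Module R M]

/-- The embedding of `M` into its `w`-envelope. -/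
noncomputable def toWEnvelope : M →ₗ[R] wEnvelope R M :=
  (injHullMap R M).codRestrict _ fun x => le_gvClosure _ ⟨x, rfl⟩

theorem toWEnvelope_injective : Function.Injective (toWEnvelope R M) := fun _ _ h =>
  (isInjectiveHull_injHullMap R M).1 (congrArg Subtype.val h)

theorem isGVTorsion_quotient_range_toWEnvelope :
    IsGVTorsion R (wEnvelope R M ⧸ LinearMap.range (toWEnvelope R M)) := by
  rw [isGVTorsion_iff]
  intro x
  obtain ⟨⟨x, J, hJ, hx⟩, rfl⟩ := Submodule.mkQ_surjective _ x
  refine ⟨J, hJ, fun j hj => ?_⟩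
  rw [← map_smul, Submodule.mkQ_apply, Submodule.Quotient.mk_eq_zero]
  obtain ⟨y, hy⟩ := hx j hj
  exact ⟨y, Subtype.ext hy⟩

theorem isGVTorsionFree_LMod : IsGVTorsionFree R (LMod R M) :=
  ((isInjectiveHull_injHullMap R _).isGVTorsionFree isGVTorsionFree_quotient_torGV).of_injective _
    (Submodule.injective_subtype _)

variable {R M}

/-- For a w-module N the maps Ext¹(L(M), N) → Ext¹(M/tor, N) → Ext¹(M, N) are injective: the
cokernel of M/tor → L(M) and the kernel of M → M/tor are GV-torsion, so Ext¹ of the first and Hom of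
the second into N vanish. -/
theorem IsWSplit.isWProjective (hM : IsWSplit R M) : IsWProjective R M := by
  intro N _ _ _ hN
  have h1 := extPrecomp_injective_of_left (N := N) (torGV R M).injective_subtype
    (LinearMap.exact_subtype_mkQ _) (Submodule.mkQ_surjective _) 0
    (ext_zero_subsingleton (isGVTorsion_torGV.linearMap_eq_zero hN.1))
  have h2 := extPrecomp_injective_of_right (N := N) (toWEnvelope_injective R (M ⧸ torGV R M))
    (LinearMap.exact_map_mkQ_range _) (Submodule.mkQ_surjective _) 1
    (hN.ext_one_subsingleton (isGVTorsion_quotient_range_toWEnvelope R _))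
  exact ((hM N).of_injective _ h1).of_injective _ h2

theorem IsWSplit.isWeakWProjective (hM : IsWSplit R M) : IsWeakWProjective R M :=
  fun _ _ _ hN => hN.2 M hM.isWProjective 1 le_rfl

/-- The kernel of a free cover of L(M) is a torsion-free w-module, so it is an admissible
coefficient module in the definition of w-projectivity. -/
theorem IsWProjective.exists_isGVIdeal_le_liftIdeal (hM : IsWProjective R M) :
    ∃ J : Ideal R, IsGVIdeal R J ∧
      J ≤ liftIdeal (Finsupp.linearCombination R (id : LMod R M → LMod R M)) :=
  WOp.exists_isGVIdeal_le_liftIdeal (Finsupp.linearCombination_id_surjective R _)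
    (hM _ inferInstance ((isWModule_finsupp _).ker (isGVTorsionFree_LMod R M) _))

end Envelope

/-! ### Vanishing of Ext into modules local at a maximal w-ideal -/

section LocalCoefficients

variable {R : Type u} [CommRing R] {m : Ideal R}

/-- Multiplication by s on Ext is induced by an automorphism of N, so it can be undone. -/
theorem smul_ext_injective_of_isLocalAt {X N : Type u} [AddCommGroup X] [Module R X]
    [AddCommGroup N] [Module R N] (hN : IsLocalAt m N) {s : R} (hs : s ∉ m) (n : ℕ)
    {e : ExtR R X N n} (he : s • e = 0) : e = 0 := by
  let u : N ≃ₗ[R] N := LinearEquiv.ofBijective (s • LinearMap.id) (hN s hs)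
  have h1 : extPostcomp X u.symm.toLinearMap n (extPostcomp X (s • LinearMap.id) n e) = e := by
    have h2 : u.symm.toLinearMap ∘ₗ (s • LinearMap.id) = (1 : R) • LinearMap.id := by
      rw [one_smul]
      exact u.symm_comp
    rw [extPostcomp_comp, h2, extPostcomp_smul_id, one_smul]
  rw [← h1, extPostcomp_smul_id, he, map_zero]

/-- A module that is local at `m` embeds into an injective module that is local at `m`. -/
theorem IsLocalAt.exists_injective [m.IsPrime] {N : Type u} [AddCommGroup N] [Module R N]
    (hN : IsLocalAt m N) : ∃ (E : ModuleCat.{u} R) (i : N →ₗ[R] E),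
      Function.Injective i ∧ Module.Injective R E ∧ IsLocalAt m E := by
  let S := m.primeCompl
  let E₀ := Injective.under (ModuleCat.of (Localization S) (LocalizedModule S N))
  let E : Type u := E₀
  let i₀ : LocalizedModule S N →ₗ[Localization S] E :=
    (Injective.ι (ModuleCat.of (Localization S) (LocalizedModule S N))).hom
  have hi₀ : Function.Injective i₀ := (ModuleCat.mono_iff_injective _).mp
    (Injective.ι_mono (ModuleCat.of (Localization S) (LocalizedModule S N)))
  have : Injective (ModuleCat.of (Localization S) E) :=
    Injective.injective_under (ModuleCat.of (Localization S) (LocalizedModule S N))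
  have hE₀ : Module.Injective (Localization S) E :=
    Module.injective_module_of_injective_object (Localization S) E
  let _ : Module R E := Module.compHom E (algebraMap R (Localization S))
  have : IsScalarTower R (Localization S) E := IsScalarTower.of_algebraMap_smul fun _ _ => rfl
  have := isLocalizedModule_id S E (Localization S)
  refine ⟨ModuleCat.of R E, i₀.restrictScalars R ∘ₗ LocalizedModule.mkLinearMap S N,
    hi₀.comp ?_, injective_of_injective_localization S E hE₀,
    IsLocalAt.of_isLocalizedModule (LinearMap.id : E →ₗ[R] E)⟩
  intro x y hxy
  obtain ⟨c, hc⟩ := IsLocalizedModule.exists_of_eq (S := S) hxy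
  exact (hN c c.2).1 hc

/-- Dimension shifting: N embeds into a local injective module with local quotient, and in degree 0
there are no maps from a GV-torsion module to a GV-torsion-free one. -/
theorem IsGVTorsion.ext_subsingleton (hm : IsMaximalWIdeal R m) {T : Type u} [AddCommGroup T]
    [Module R T] (hT : IsGVTorsion R T) (n : ℕ) :
    ∀ (N : Type u) [AddCommGroup N] [Module R N], IsLocalAt m N →
      Subsingleton (ExtR R T N n) := by
  have := hm.isPrime
  induction n with
  | zero =>
    exact fun N _ _ hN => ext_zero_subsingleton (hT.linearMap_eq_zero (hN.isGVTorsionFree hm))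
  | succ n ih =>
    intro N _ _ hN
    obtain ⟨E, i, hi, hE, hEm⟩ := hN.exists_injective
    exact ext_subsingleton_shift hi (LinearMap.exact_map_mkQ_range i) (Submodule.mkQ_surjective _) n
      (ih _ (hEm.quotient (hN.congr (LinearEquiv.ofInjective i hi))))
      (ext_subsingleton_of_injective n)

/-- Some s ∉ m both kills Ext(L(P), N) and acts injectively on it. Vanishing then passes to P/tor
and to P, since the modules in between are GV-torsion. -/
theorem IsWProjective.ext_subsingleton (hm : IsMaximalWIdeal R m) {P : Type u} [AddCommGroup P]
    [Module R P] (hP : IsWProjective R P) {N : Type u} [AddCommGroup N] [Module R N]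
    (hN : IsLocalAt m N) (n : ℕ) : Subsingleton (ExtR R P N (n + 1)) := by
  obtain ⟨J, hJ, hle⟩ := hP.exists_isGVIdeal_le_liftIdeal
  obtain ⟨s, hs, hsm⟩ := SetLike.not_le_iff_exists.mp (hm.not_le hJ)
  have hL : Subsingleton (ExtR R (LMod R P) N (n + 1)) := subsingleton_of_forall_eq 0 fun e =>
    smul_ext_injective_of_isLocalAt hN hsm _ (smul_ext_eq_zero_of_mem_liftIdeal (hle hs) n e)
  have hV := ext_subsingleton_left (N := N) (toWEnvelope_injective R (P ⧸ torGV R P))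
    (LinearMap.exact_map_mkQ_range _) (Submodule.mkQ_surjective _) (n + 1) hL
    ((isGVTorsion_quotient_range_toWEnvelope R _).ext_subsingleton hm _ N hN)
  exact ext_subsingleton_middle (torGV R P).injective_subtype
    (LinearMap.exact_subtype_mkQ _) (Submodule.mkQ_surjective _) (n + 1)
    (isGVTorsion_torGV.ext_subsingleton hm _ N hN) hV

theorem IsLocalAt.inPwDagger (hm : IsMaximalWIdeal R m) {N : Type u} [AddCommGroup N] [Module R N]
    (hN : IsLocalAt m N) : InPwDagger R N := by
  refine ⟨hN.isGVTorsionFree hm, fun P _ _ hP k hk => ?_⟩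
  obtain ⟨n, rfl⟩ := Nat.exists_eq_add_of_le' hk
  exact hP.ext_subsingleton hm hN n

end LocalCoefficients

/-! ### Localized exactness in terms of elements -/

section Elementwise

variable {R : Type u} [CommRing R] {m : Ideal R} (hm : m.IsPrime)
variable {A B C : Type u} [AddCommGroup A] [Module R A] [AddCommGroup B] [Module R B]
  [AddCommGroup C] [Module R C]

/-- The canonical map `A → A_m`. -/
noncomputable abbrev toLoc (m : Ideal R) (hm : m.IsPrime) (A : Type u) [AddCommGroup A]
    [Module R A] : A →ₗ[R] LocalizedModule m.primeCompl A :=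
  LocalizedModule.mkLinearMap m.primeCompl A

theorem locMap_toLoc (f : A →ₗ[R] B) (a : A) :
    locMap m hm f (toLoc m hm A a) = toLoc m hm B (f a) := by
  simp [locMap, toLoc, LocalizedModule.mkLinearMap_apply, LocalizedModule.map_mk]

theorem toLoc_eq_iff {a b : A} :
    toLoc m hm A a = toLoc m hm A b ↔ ∃ s ∉ m, s • a = s • b := by
  rw [IsLocalizedModule.eq_iff_exists m.primeCompl]
  exact ⟨fun ⟨s, h⟩ => ⟨s, s.2, h⟩, fun ⟨s, hs, h⟩ => ⟨⟨s, hs⟩, h⟩⟩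

theorem exists_smul_eq_toLoc (x : LocalizedModule m.primeCompl A) :
    ∃ s ∉ m, ∃ a, s • x = toLoc m hm A a := by
  obtain ⟨⟨a, s⟩, h⟩ := IsLocalizedModule.surj m.primeCompl (toLoc m hm A) x
  exact ⟨s, s.2, a, h⟩

theorem isLocalAt_localizedModule (A : Type u) [AddCommGroup A] [Module R A] :
    IsLocalAt m (LocalizedModule m.primeCompl A) :=
  IsLocalAt.of_isLocalizedModule (toLoc m hm A)

theorem locMap_injective_iff {f : A →ₗ[R] B} :
    Function.Injective (locMap m hm f) ↔ ∀ a, f a = 0 → ∃ s ∉ m, s • a = 0 := by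
  have hloc := isLocalAt_localizedModule hm A
  constructor
  · intro h a ha
    have h1 : toLoc m hm A a = toLoc m hm A 0 := h (by
      rw [locMap_toLoc, ha, map_zero, map_zero, map_zero])
    simpa using (toLoc_eq_iff hm).mp h1
  · intro h
    refine (injective_iff_map_eq_zero _).mpr fun x hx => ?_
    obtain ⟨s, hs, a, ha⟩ := exists_smul_eq_toLoc hm x
    have h1 : toLoc m hm B (f a) = toLoc m hm B 0 := by
      rw [← locMap_toLoc, ← ha, LinearMap.map_smul_of_tower, hx, smul_zero, map_zero]
    obtain ⟨t, ht, hta⟩ := (toLoc_eq_iff hm).mp h1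
    obtain ⟨r, hr, hra⟩ := h (t • a) (by rw [map_smul, hta, smul_zero])
    refine (hloc s hs).1 ((hloc t ht).1 ((hloc r hr).1 ?_))
    simp only [ha, ← map_smul, hra, map_zero, smul_zero]

theorem locMap_surjective_iff {g : B →ₗ[R] C} :
    Function.Surjective (locMap m hm g) ↔ ∀ c, ∃ s ∉ m, ∃ b, g b = s • c := by
  constructor
  · intro h c
    obtain ⟨x, hx⟩ := h (toLoc m hm C c)
    obtain ⟨s, hs, b, hb⟩ := exists_smul_eq_toLoc hm x
    have h1 : toLoc m hm C (g b) = toLoc m hm C (s • c) := by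
      rw [← locMap_toLoc, ← hb, LinearMap.map_smul_of_tower, hx, map_smul]
    obtain ⟨t, ht, htb⟩ := (toLoc_eq_iff hm).mp h1
    exact ⟨t * s, hm.mul_notMem ht hs, t • b, by rw [map_smul, htb, mul_smul]⟩
  · intro h x
    obtain ⟨s, hs, c, hc⟩ := exists_smul_eq_toLoc hm x
    obtain ⟨t, ht, b, hb⟩ := h c
    obtain ⟨y, hy⟩ := (isLocalAt_localizedModule hm B _ (hm.mul_notMem ht hs)).2 (toLoc m hm B b)
    refine ⟨y, (isLocalAt_localizedModule hm C _ (hm.mul_notMem ht hs)).1 ?_⟩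
    simp only at hy ⊢
    rw [← LinearMap.map_smul_of_tower, hy, locMap_toLoc, hb, mul_smul, hc, map_smul]

theorem locMap_exact_iff {f : A →ₗ[R] B} {g : B →ₗ[R] C} :
    Function.Exact (locMap m hm f) (locMap m hm g) ↔
      (∀ a, ∃ s ∉ m, s • g (f a) = 0) ∧ ∀ b, g b = 0 → ∃ s ∉ m, ∃ a, f a = s • b := by
  constructor
  · intro h
    refine ⟨fun a => ?_, fun b hb => ?_⟩
    · have h1 := h.apply_apply_eq_zero (toLoc m hm A a)
      rw [locMap_toLoc, locMap_toLoc, ← map_zero (toLoc m hm C), toLoc_eq_iff] at h1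
      simpa using h1
    · obtain ⟨x, hx⟩ := (h (toLoc m hm B b)).mp (by rw [locMap_toLoc, hb, map_zero])
      obtain ⟨s, hs, a, ha⟩ := exists_smul_eq_toLoc hm x
      have h1 : toLoc m hm B (f a) = toLoc m hm B (s • b) := by
        rw [← locMap_toLoc, ← ha, LinearMap.map_smul_of_tower, hx, map_smul]
      obtain ⟨t, ht, hta⟩ := (toLoc_eq_iff hm).mp h1
      exact ⟨t * s, hm.mul_notMem ht hs, t • a, by rw [map_smul, hta, mul_smul]⟩
  · rintro ⟨h1, h2⟩ y
    constructor
    · intro hy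
      obtain ⟨s, hs, b, hb⟩ := exists_smul_eq_toLoc hm y
      have h3 : toLoc m hm C (g b) = toLoc m hm C 0 := by
        rw [← locMap_toLoc, ← hb, LinearMap.map_smul_of_tower, hy, smul_zero, map_zero]
      obtain ⟨t, ht, htb⟩ := (toLoc_eq_iff hm).mp h3
      obtain ⟨r, hr, a, ha⟩ := h2 (t • b) (by rw [map_smul, htb, smul_zero])
      have hrts := hm.mul_notMem (hm.mul_notMem hr ht) hs
      obtain ⟨x, hx⟩ := (isLocalAt_localizedModule hm A _ hrts).2 (toLoc m hm A a)
      refine ⟨x, (isLocalAt_localizedModule hm B _ hrts).1 ?_⟩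
      simp only at hx ⊢
      rw [← LinearMap.map_smul_of_tower, hx, locMap_toLoc, ha, mul_smul, hb, map_smul, map_smul,
        mul_smul]
    · rintro ⟨x, rfl⟩
      obtain ⟨s, hs, a, ha⟩ := exists_smul_eq_toLoc hm x
      obtain ⟨t, ht, hta⟩ := h1 a
      have hloc := isLocalAt_localizedModule hm C
      refine (hloc s hs).1 ((hloc t ht).1 ?_)
      have h3 : s • locMap m hm g (locMap m hm f x) = toLoc m hm C (g (f a)) := by
        rw [← locMap_toLoc, ← locMap_toLoc, ← ha, LinearMap.map_smul_of_tower,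
          LinearMap.map_smul_of_tower]
      simp only [h3, ← map_smul, hta, map_zero, smul_zero]

end Elementwise

/-! ### Clearing denominators for maps out of finitely presented modules -/

section FinitePresentation

variable {R : Type u} [CommRing R] {m : Ideal R} (hm : m.IsPrime)
variable {M A : Type u} [AddCommGroup M] [Module R M] [AddCommGroup A] [Module R A]

theorem exists_smul_eq_of_toLoc_comp_eq [Module.Finite R M] {φ ψ : M →ₗ[R] A}
    (h : toLoc m hm A ∘ₗ φ = toLoc m hm A ∘ₗ ψ) : ∃ s ∉ m, s • φ = s • ψ := by
  obtain ⟨s, hs⟩ := Module.Finite.exists_smul_of_comp_eq_of_isLocalizedModule m.primeCompl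
    (toLoc m hm A) φ ψ h
  exact ⟨s, s.2, hs⟩

theorem exists_toLoc_comp_eq_smul [Module.FinitePresentation R M]
    (φ : M →ₗ[R] LocalizedModule m.primeCompl A) :
    ∃ s ∉ m, ∃ ψ : M →ₗ[R] A, toLoc m hm A ∘ₗ ψ = s • φ := by
  obtain ⟨ψ, s, hs⟩ := Module.FinitePresentation.exists_lift_of_isLocalizedModule m.primeCompl
    (toLoc m hm A) φ
  exact ⟨s, s.2, ψ, hs⟩

/-- `w`-exact sequences stay `w`-exact under `Hom(M, -)` if multiplication by a GV-ideal on the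
finitely presented module `M` factors through a projective module. -/
theorem IsWShortExact.compRight [Module.FinitePresentation R M] {F : Type u} [AddCommGroup F]
    [Module R F] [Module.Projective R F] {π : F →ₗ[R] M} {J : Ideal R} (hJ : IsGVIdeal R J)
    (hle : J ≤ liftIdeal π) {B C : Type u} [AddCommGroup B] [Module R B] [AddCommGroup C]
    [Module R C] {f : A →ₗ[R] B} {g : B →ₗ[R] C} (h : IsWShortExact f g) :
    IsWShortExact (f.compRight R : (M →ₗ[R] A) →ₗ[R] (M →ₗ[R] B))
      (g.compRight R : (M →ₗ[R] B) →ₗ[R] (M →ₗ[R] C)) := by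
  intro m hmax
  have hm := hmax.isPrime
  obtain ⟨hf, hfg, hg⟩ := h m hmax
  refine ⟨(locMap_injective_iff hm).mpr fun φ hφ => ?_,
    (locMap_exact_iff hm).mpr ⟨fun φ => ?_, fun ψ hψ => ?_⟩,
    (locMap_surjective_iff hm).mpr fun χ => ?_⟩
  · obtain ⟨s, hs, h0⟩ := exists_smul_eq_of_toLoc_comp_eq hm (φ := φ) (ψ := 0) (by
      ext x
      apply hf
      have : f (φ x) = 0 := LinearMap.congr_fun hφ x
      simp only [LinearMap.comp_apply, locMap_toLoc, this, LinearMap.zero_apply, map_zero])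
    exact ⟨s, hs, by rw [h0, smul_zero]⟩
  · obtain ⟨s, hs, h0⟩ := exists_smul_eq_of_toLoc_comp_eq hm (φ := g ∘ₗ f ∘ₗ φ) (ψ := 0) (by
      ext x
      have := hfg.apply_apply_eq_zero (toLoc m hm A (φ x))
      rw [locMap_toLoc, locMap_toLoc] at this
      simpa using this)
    exact ⟨s, hs, by rw [smul_zero] at h0; exact h0⟩
  -- As gψ = 0, the map M → B → B_m lands in the image of A_m; the lift to A_m is then cleared of
  -- denominators.
  · let e := LinearEquiv.ofInjective ((locMap m hm f).restrictScalars R) hf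
    let φ' : M →ₗ[R] LocalizedModule m.primeCompl A := e.symm.toLinearMap ∘ₗ
      (toLoc m hm B ∘ₗ ψ).codRestrict (LinearMap.range ((locMap m hm f).restrictScalars R))
        fun x => (hfg _).mp (by
          have : g (ψ x) = 0 := LinearMap.congr_fun hψ x
          rw [LinearMap.comp_apply, locMap_toLoc, this, map_zero])
    have hφ' : ∀ x, locMap m hm f (φ' x) = toLoc m hm B (ψ x) := fun x =>
      congrArg Subtype.val (e.apply_symm_apply _)
    obtain ⟨s, hs, φ, hφ⟩ := exists_toLoc_comp_eq_smul hm φ'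
    obtain ⟨t, ht, h0⟩ := exists_smul_eq_of_toLoc_comp_eq hm (φ := f ∘ₗ φ) (ψ := s • ψ) (by
      ext x
      have h1 : toLoc m hm A (φ x) = s • φ' x := LinearMap.congr_fun hφ x
      rw [LinearMap.comp_apply, LinearMap.comp_apply, ← locMap_toLoc, h1,
        LinearMap.map_smul_of_tower, hφ', LinearMap.comp_apply, LinearMap.smul_apply, map_smul])
    exact ⟨t * s, hm.mul_notMem ht hs, t • φ, by rw [map_smul, mul_smul]; exact h0⟩
  -- M need not be projective, but d·id_M = πη with d ∉ m: lift χπ along the surjection B_m → C_m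
  -- using F, then precompose with η.
  · obtain ⟨d, hd, hdm⟩ := SetLike.not_le_iff_exists.mp (hmax.not_le hJ)
    obtain ⟨η, hη⟩ := mem_liftIdeal.mp (hle hd)
    obtain ⟨θ, hθ⟩ := Module.projective_lifting_property ((locMap m hm g).restrictScalars R)
      (toLoc m hm C ∘ₗ χ ∘ₗ π) hg
    obtain ⟨s, hs, ψ, hψ⟩ := exists_toLoc_comp_eq_smul hm (θ ∘ₗ η)
    obtain ⟨t, ht, h0⟩ := exists_smul_eq_of_toLoc_comp_eq hm (φ := g ∘ₗ ψ) (ψ := (s * d) • χ) (by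
      ext x
      have h1 : toLoc m hm B (ψ x) = s • θ (η x) := LinearMap.congr_fun hψ x
      have h2 : locMap m hm g (θ (η x)) = toLoc m hm C (χ (π (η x))) :=
        LinearMap.congr_fun hθ (η x)
      have h3 : π (η x) = d • x := LinearMap.congr_fun hη x
      rw [LinearMap.comp_apply, LinearMap.comp_apply, ← locMap_toLoc, h1,
        LinearMap.map_smul_of_tower, h2, h3, LinearMap.comp_apply, LinearMap.smul_apply, map_smul,
        map_smul, map_smul, mul_smul])
    exact ⟨t * (s * d), hm.mul_notMem ht (hm.mul_notMem hs hdm), t • ψ, by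
      rw [map_smul, mul_smul]; exact h0⟩

/-- If `Ext¹(M, K_m) = 0` for the finitely generated kernel `K` of a surjection `π` from a finitely
presented projective module, then multiplication by some `s ∉ m` lifts along `π`. -/
theorem exists_mem_liftIdeal_of_ext_subsingleton {F : Type u} [AddCommGroup F] [Module R F]
    [Module.FinitePresentation R F] {π : F →ₗ[R] M} (hπ : Function.Surjective π)
    [Module.Finite R (LinearMap.ker π)]
    (h : Subsingleton (ExtR R M (LocalizedModule m.primeCompl (LinearMap.ker π)) 1)) :
    ∃ s ∉ m, s ∈ liftIdeal π := by
  have hexact := LinearMap.exact_subtype_ker_map π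
  obtain ⟨ψ, hψ⟩ := exists_extension_of_ext_subsingleton (LinearMap.ker π).injective_subtype
    hexact hπ h (toLoc m hm _)
  obtain ⟨s, hs, φ, hφ⟩ := exists_toLoc_comp_eq_smul hm ψ
  obtain ⟨t, ht, h0⟩ := exists_smul_eq_of_toLoc_comp_eq hm
    (φ := φ ∘ₗ (LinearMap.ker π).subtype) (ψ := s • LinearMap.id) (by
      rw [← LinearMap.comp_assoc, hφ, LinearMap.smul_comp, hψ, LinearMap.comp_smul,
        LinearMap.comp_id])
  -- On ker π the map tφ is multiplication by ts, so ρ vanishes there and descends to M; composing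
  -- with π gives ts·id_M because φ takes values in ker π.
  let ρ : F →ₗ[R] F := (t * s) • LinearMap.id - (LinearMap.ker π).subtype ∘ₗ (t • φ)
  have hρ : LinearMap.ker π ≤ LinearMap.ker ρ := fun x hx => by
    have h1 := congrArg Subtype.val (LinearMap.congr_fun h0 ⟨x, hx⟩)
    have h2 : t • (φ x : F) = t • s • x := h1
    simp [ρ, h2, mul_smul]
  let e := π.quotKerEquivOfSurjective hπ
  refine ⟨t * s, hm.mul_notMem ht hs, mem_liftIdeal.mpr
    ⟨(LinearMap.ker π).liftQ ρ hρ ∘ₗ e.symm.toLinearMap, ?_⟩⟩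
  ext x
  obtain ⟨y, rfl⟩ := hπ x
  have h1 : e.symm (π y) = (LinearMap.ker π).mkQ y := by
    rw [LinearEquiv.symm_apply_eq]; rfl
  have h2 : π (φ y) = 0 := (φ y).2
  simp [h1, ρ, h2]

end FinitePresentation

end WOp

/-! ### The equivalence -/

theorem mainTheorem5 (R : Type u) [CommRing R] (M : Type u) [AddCommGroup M] [Module R M]
    [Module.FinitePresentation R M] :
    List.TFAE [
      WOp.IsWSplit R M,
      WOp.IsWeakWProjective R M,
      ∀ (A B C : Type u) [AddCommGroup A] [AddCommGroup B] [AddCommGroup C]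
        [Module R A] [Module R B] [Module R C] (f : A →ₗ[R] B) (g : B →ₗ[R] C),
        WOp.IsWShortExact f g →
          WOp.IsWShortExact (f.compRight R : (M →ₗ[R] A) →ₗ[R] (M →ₗ[R] B))
            (g.compRight R : (M →ₗ[R] B) →ₗ[R] (M →ₗ[R] C))] := by
  obtain ⟨n, π₀, hπ₀⟩ := Module.Finite.exists_fin' R M
  -- The index type is lifted so that the free module is built from types in the universe of R.
  let π : (ULift.{u} (Fin n) → R) →ₗ[R] M :=
    π₀ ∘ₗ (LinearEquiv.funCongrLeft R R Equiv.ulift.symm).toLinearMap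
  have hπ : Function.Surjective π := hπ₀.comp (LinearEquiv.surjective _)
  have : Module.Finite R (LinearMap.ker π) :=
    Module.Finite.iff_fg.mpr (Module.FinitePresentation.fg_ker π hπ)
  have key (h : ∀ m (hm : WOp.IsMaximalWIdeal R m), ∃ s ∉ m, s ∈ WOp.liftIdeal π) :
      WOp.IsWSplit R M := by
    obtain ⟨J, hJ, hle⟩ := WOp.exists_isGVIdeal_le fun m hm hle => by
      obtain ⟨s, hs, hs'⟩ := h m hm
      exact hs (hle hs')
    exact WOp.isWSplit_of_isGVIdeal_le_liftIdeal hJ hle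
  tfae_have 1 → 2 := WOp.IsWSplit.isWeakWProjective
  tfae_have 2 → 1 := fun h => key fun m hm =>
    WOp.exists_mem_liftIdeal_of_ext_subsingleton hm.isPrime hπ
      (h _ ((WOp.isLocalAt_localizedModule hm.isPrime _).inPwDagger hm))
  tfae_have 1 → 3 := by
    intro h A B C _ _ _ _ _ _ f g hfg
    obtain ⟨J, hJ, hle⟩ := WOp.exists_isGVIdeal_le_liftIdeal hπ (h _)
    exact hfg.compRight hJ hle
  tfae_have 3 → 1 := by
    intro h
    refine key fun m hm => ?_
    have hexact : WOp.IsWShortExact (LinearMap.ker π).subtype π := fun p hp =>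
      ⟨LocalizedModule.map_injective _ _ (LinearMap.ker π).injective_subtype,
        LocalizedModule.map_exact _ _ _ (LinearMap.exact_subtype_ker_map π),
        LocalizedModule.map_surjective _ _ hπ⟩
    -- Local surjectivity of Hom(M, F) → Hom(M, M) at id_M says exactly that some s ∉ m lies in
    -- `liftIdeal π`.
    exact (WOp.locMap_surjective_iff hm.isPrime).mp (h _ _ _ _ _ hexact m hm).2.2 LinearMap.id
  tfae_finish
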